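/- Let $\mathfrak{S}_n$ be the set of permutations $\sigma=\sigma_1\sigma_2\cdots\sigma_n$ of $\{1,\dots,n\}$, with the convention $\sigma_0=\sigma_{n+1}=+\infty$. Let $\mathrm{des}(\sigma)$ be the number of $i\in\{1,\dots,n-1\}$ with $\sigma_i>\sigma_{i+1}$, let $\mathrm{inv}(\sigma)$ be the number of pairs $i<j$ with $\sigma_i>\sigma_j$, and let $\mathrm{dd}(\sigma)$ be the number of non-initial double descents of $\sigma$, that is, of $i\in\{2,\dots,n\}$ with $\sigma_{i-1}>\sigma_i>\sigma_{i+1}$. Put $$\gamma_{n,k}(q)=\sum_{\substack{\sigma\in\mathfrak{S}_n,\ \mathrm{dd}(\sigma)=0\\ \sigma_1<\sigma_2,\ \mathrm{des}(\sigma)=k}}q^{\mathrm{inv}(\sigma)},\qquad \tilde\gamma_{n,k}(q)=\sum_{\substack{\sigma\in\mathfrak{S}_n,\ \mathrm{dd}(\sigma)=0\\ \mathrm{des}(\sigma)=k}}q^{\mathrm{inv}(\sigma)},$$ and define the $\gamma$-polynomials $$\Gamma_n(y,q)=\sum_{k=0}^{\lfloor (n-1)/2\rfloor}\gamma_{n,k}(q)\,y^k\quad(n\ge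 1),\qquad \tilde\Gamma_n(y,q)=\sum_{k=0}^{\lfloor n/2\rfloor}\tilde\gamma_{n,k}(q)\,y^k\quad(n\ge 0).$$ Let ${n\brack k}_q=\dfrac{(q;q)_n}{(q;q)_k\,(q;q)_{n-k}}$ with $(q;q)_n=\prod_{i=1}^n(1-q^i)$. Then for every integer $n\ge 0$ the following identity of polynomials in $y$ and $q$ holds: $$\tilde\Gamma_{n+1}(y,q)=\tilde\Gamma_n(y,q)+y\sum_{k=1}^n{n\brack k}_q\,q^k\,\Gamma_k(y,q)\,\tilde\Gamma_{n-k}(y,q).$$ -/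

import Mathlib

namespace QBinomialEulerian

open Polynomial

/-! Permutations of `[n]` are elements of `Equiv.Perm (Fin n)`; letters are `0, …, n - 1`
instead of `1, …, n`, positions in `word` are `1, …, n`. -/

/-- The one-line word `σ₁ σ₂ ⋯ σₙ` of `σ`, with the convention `σ₀ = σₙ₊₁ = +∞`. -/
def word {n : ℕ} (σ : Equiv.Perm (Fin n)) (i : ℕ) : WithTop (Fin n) :=
  if h : 1 ≤ i ∧ i ≤ n then ((σ ⟨i - 1, by omega⟩ : Fin n) : WithTop (Fin n)) else ⊤

/-- The number of descents: `i ∈ [n-1]` with `σᵢ > σᵢ₊₁`. -/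
def des {n : ℕ} (σ : Equiv.Perm (Fin n)) : ℕ :=
  ((Finset.Icc 1 (n - 1)).filter fun i => word σ i > word σ (i + 1)).card

/-- The number of inversions. -/
def inv {n : ℕ} (σ : Equiv.Perm (Fin n)) : ℕ :=
  (Finset.univ.filter fun p : Fin n × Fin n => p.1 < p.2 ∧ σ p.1 > σ p.2).card

/-- The number of non-initial double descents: `2 ≤ i ≤ n` with `σᵢ₋₁ > σᵢ > σᵢ₊₁`
(where `σₙ₊₁ = +∞`). -/
def dd {n : ℕ} (σ : Equiv.Perm (Fin n)) : ℕ :=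
  ((Finset.Icc 2 n).filter fun i =>
    word σ (i - 1) > word σ i ∧ word σ i > word σ (i + 1)).card

/-- `Γ_{n,k}`: permutations with no non-initial double descent, with `σ₁ < σ₂`, and with
`k` descents. -/
def gammaSet (n k : ℕ) : Finset (Equiv.Perm (Fin n)) :=
  Finset.univ.filter fun σ => dd σ = 0 ∧ word σ 1 < word σ 2 ∧ des σ = k

/-- `Γ̃_{n,k}`: permutations with no non-initial double descent and with `k` descents. -/
def gammaTildeSet (n k : ℕ) : Finset (Equiv.Perm (Fin n)) :=
  Finset.univ.filter fun σ => dd σ = 0 ∧ des σ = k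

/-- `γ_{n,k}(q)`, a polynomial in `q = X`. -/
noncomputable def gammaCoeff (n k : ℕ) : Polynomial ℚ :=
  ∑ σ ∈ gammaSet n k, X ^ inv σ

/-- `γ̃_{n,k}(q)`, a polynomial in `q = X`. -/
noncomputable def gammaTildeCoeff (n k : ℕ) : Polynomial ℚ :=
  ∑ σ ∈ gammaTildeSet n k, X ^ inv σ

/-- The polynomial `Γ_n(y, q)`; the outer variable is `y`, the inner variable is `q`. -/
noncomputable def gammaPoly (n : ℕ) : Polynomial (Polynomial ℚ) :=
  ∑ k ∈ Finset.range ((n - 1) / 2 + 1), C (gammaCoeff n k) * X ^ k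

/-- The polynomial `Γ̃_n(y, q)`; the outer variable is `y`, the inner variable is `q`. -/
noncomputable def gammaTildePoly (n : ℕ) : Polynomial (Polynomial ℚ) :=
  ∑ k ∈ Finset.range (n / 2 + 1), C (gammaTildeCoeff n k) * X ^ k

/-- `(q; q)_n = ∏_{i=1}^n (1 - q^i)`. -/
noncomputable def qPoch (n : ℕ) : Polynomial ℚ :=
  ∏ i ∈ Finset.Icc 1 n, (1 - X ^ i)

/-- The `q`-binomial coefficient `(q; q)_n / ((q; q)_m (q; q)_{n-m})` for `m ≤ n`; the
division of polynomials is exact, see `qBinom_mul`. -/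
noncomputable def qBinom (n m : ℕ) : Polynomial ℚ :=
  qPoch n / (qPoch m * qPoch (n - m))

theorem qPoch_succ (n : ℕ) : qPoch (n + 1) = qPoch n * (1 - X ^ (n + 1)) := by
  unfold qPoch
  rw [Finset.prod_Icc_succ_top (by omega)]

theorem qPoch_ne_zero (n : ℕ) : qPoch n ≠ 0 := by
  unfold qPoch
  refine Finset.prod_ne_zero_iff.mpr fun i hi h => ?_
  have h1 : 1 ≤ i := (Finset.mem_Icc.mp hi).1
  have := congrArg (Polynomial.eval 0) h
  simp [show i ≠ 0 by omega] at this

theorem qPoch_dvd (a b : ℕ) : qPoch a * qPoch b ∣ qPoch (a + b) := by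
  induction h : a + b generalizing a b with
  | zero =>
    obtain ⟨rfl, rfl⟩ : a = 0 ∧ b = 0 := by omega
    simp [qPoch]
  | succ n ih =>
    rcases a with _ | a
    · have : b = n + 1 := by omega
      subst this
      simp [qPoch]
    rcases b with _ | b
    · have : a = n := by omega
      subst this
      simp [qPoch]
    obtain ⟨c, hc⟩ := ih a (b + 1) (by omega)
    obtain ⟨d, hd⟩ := ih (a + 1) b (by omega)
    have hn : n + 1 = (a + 1) + (b + 1) := by omega
    refine ⟨c + X ^ (a + 1) * d, ?_⟩
    rw [qPoch_succ n]
    have e : (1 - X ^ (n + 1) : Polynomial ℚ)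
        = (1 - X ^ (a + 1)) + X ^ (a + 1) * (1 - X ^ (b + 1)) := by
      rw [hn, pow_add]; ring
    rw [e, mul_add, ← mul_assoc]
    nth_rewrite 1 [hc]
    rw [hd, qPoch_succ a, qPoch_succ b]
    ring

/-- Exactness of the division in the definition of `qBinom`. -/
theorem qBinom_mul {n m : ℕ} (h : m ≤ n) :
    qBinom n m * (qPoch m * qPoch (n - m)) = qPoch n := by
  have hd := qPoch_dvd m (n - m)
  rw [Nat.add_sub_cancel' h] at hd
  unfold qBinom
  rw [mul_comm]
  exact EuclideanDomain.mul_div_cancel' (mul_ne_zero (qPoch_ne_zero _) (qPoch_ne_zero _)) hd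

end QBinomialEulerian

/-! Cut a word on `n + 1` letters at its largest letter, `a m b`. The last letter of `a` does not
descend, whether followed by `m` or by the end, so `a` is an arbitrary word without non-initial
double descents. If `b` is nonempty, `m` starts a descent, so `b` must in addition start with an
ascent. Descents add up, plus one when `b` is nonempty; inversions add up, plus `|b|`, plus the
pairs crossing from `a` to `b`. Summing over the letter set `B` of `b` gives `enumTilde_insert`.
Only relative order matters, so each factor depends only on `|B|` (`enumTilde_eq_univ`,
`enumUp_eq_univ`), and the crossings over all `B` of size `k` sum to a `q`-binomial
(`crossSum_eq_qBinom`). The case `b` empty is the first term of the recursion. -/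

namespace QBinomialEulerian

open Polynomial

/-! ### Statistics of words and their behaviour when cut at the largest letter. -/

section ListStatistics

/-- The `i`-th letter of a list (counted from `0`), with value `⊤` beyond its end. -/
def letter {α : Type*} (l : List α) (i : ℕ) : WithTop α :=
  (l[i]?).elim ⊤ (fun a => (a : WithTop α))

@[simp] theorem letter_nil {α : Type*} (i : ℕ) : letter ([] : List α) i = ⊤ := by simp [letter]

@[simp] theorem letter_cons_zero {α : Type*} (a : α) (l : List α) : letter (a :: l) 0 = a := by simp [letter]

@[simp] theorem letter_cons_succ {α : Type*} (a : α) (l : List α) (i : ℕ) :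
    letter (a :: l) (i + 1) = letter l i := by simp [letter]

@[simp] theorem letter_cons_one {α : Type*} (a : α) (l : List α) : letter (a :: l) 1 = letter l 0 :=
  letter_cons_succ a l 0

variable {α β : Type*} [LinearOrder α] [LinearOrder β]

/-- The number of descents of a list. -/
def listDes : List α → ℕ
  | [] => 0
  | a :: l => (if letter l 0 < a then 1 else 0) + listDes l

/-- The number of inversions of a list. -/
def listInv : List α → ℕ
  | [] => 0
  | a :: l => l.countP (fun b => b < a) + listInv l

/-- No letter but the first one is a double descent. -/
def NoDoubleDescent : List α → Prop
  | [] => True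
  | a :: l => ¬ (letter l 0 < a ∧ letter l 1 < letter l 0) ∧ NoDoubleDescent l

/-- The list does not start with a descent. -/
def StartsUp (l : List α) : Prop := ¬ letter l 1 < letter l 0

theorem listDes_cons (a : α) (l : List α) :
    listDes (a :: l) = (if letter l 0 < a then 1 else 0) + listDes l := rfl

theorem noDoubleDescent_cons (a : α) (l : List α) :
    NoDoubleDescent (a :: l) ↔
      ¬ (letter l 0 < a ∧ letter l 1 < letter l 0) ∧ NoDoubleDescent l := Iff.rfl

theorem listDes_append_cons (A B : List α) (m : α) (h : ∀ a ∈ A, a < m) :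
    listDes (A ++ m :: B) = listDes A + listDes (m :: B) := by
  induction A with
  | nil => simp [listDes]
  | cons a A ih =>
    have ih := ih fun x hx => h x (List.mem_cons_of_mem _ hx)
    have ha : a < m := h a (by simp)
    rw [List.cons_append, listDes_cons, ih, listDes_cons a A]
    cases A with
    | nil => simp [ha.le]
    | cons b A => simp [add_assoc]

theorem noDoubleDescent_append_cons (A B : List α) (m : α) (h : ∀ a ∈ A, a < m) :
    NoDoubleDescent (A ++ m :: B) ↔ NoDoubleDescent A ∧ NoDoubleDescent (m :: B) := by
  induction A with
  | nil => simp [NoDoubleDescent]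
  | cons a A ih =>
    have ih := ih fun x hx => h x (List.mem_cons_of_mem _ hx)
    have ha : a < m := h a (by simp)
    rw [List.cons_append, noDoubleDescent_cons, ih, noDoubleDescent_cons a A]
    match A, h with
    | [], _ => simp [ha.le]
    | [b], h =>
      have hb : b < m := h b (by simp)
      simp [hb.le]
    | b :: c :: A, _ => simp [and_assoc]

theorem letter_zero_lt {l : List α} {m : α} (hl : l ≠ []) (h : ∀ a ∈ l, a < m) :
    letter l 0 < m := by
  cases l with
  | nil => exact absurd rfl hl
  | cons a l => simpa using h a (by simp)

theorem listDes_cons_of_forall_lt (B : List α) (m : α) (h : ∀ a ∈ B, a < m) :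
    listDes (m :: B) = (if B = [] then 0 else 1) + listDes B := by
  rw [listDes]
  by_cases hB : B = []
  · simp [hB]
  · simp [hB, letter_zero_lt hB h]

/-- The largest letter `m` descends into a nonempty `B`, so the head of `B` must not descend again;
an empty `B` satisfies `StartsUp` because `⊤ < ⊤` fails. -/
theorem noDoubleDescent_cons_of_forall_lt (B : List α) (m : α) (h : ∀ a ∈ B, a < m) :
    NoDoubleDescent (m :: B) ↔ NoDoubleDescent B ∧ StartsUp B := by
  rw [NoDoubleDescent, StartsUp]
  by_cases hB : B = []
  · simp [hB]
  · simp [letter_zero_lt hB h, and_comm]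

theorem listInv_append (A B : List α) :
    listInv (A ++ B) =
      listInv A + listInv B + (A.map fun a => B.countP (fun b => b < a)).sum := by
  induction A with
  | nil => simp [listInv]
  | cons a A ih =>
    simp only [List.cons_append, listInv, ih, List.countP_append, List.map_cons, List.sum_cons]
    ring

theorem listInv_append_cons (A B : List α) (m : α) (hA : ∀ a ∈ A, a < m) (hB : ∀ b ∈ B, b < m) :
    listInv (A ++ m :: B) = listInv A + listInv B + B.length +
      (A.map fun a => B.countP (fun b => b < a)).sum := by
  have h1 : (A.map fun a => (m :: B).countP (fun b => b < a)) =
      A.map fun a => B.countP (fun b => b < a) :=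
    List.map_congr_left fun a ha => by
      rw [List.countP_cons_of_neg (by simpa using (hA a ha).le)]
  have h2 : B.countP (fun b => b < m) = B.length :=
    List.countP_eq_length.2 fun b hb => by simpa using hB b hb
  rw [listInv_append, h1, listInv, h2]
  ring

/-- Shows that the ranges of `k` in `gammaTildePoly` and `gammaPoly` omit nothing. The sharper
second bound feeds the induction: after an initial descent the tail is nonempty and starts up. -/
theorem two_mul_listDes_le (l : List α) (h : NoDoubleDescent l) :
    2 * listDes l ≤ l.length ∧ (StartsUp l → l ≠ [] → 2 * listDes l + 1 ≤ l.length) := by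
  induction l with
  | nil => simp [listDes]
  | cons a l ih =>
    rw [NoDoubleDescent] at h
    obtain ⟨ih1, ih2⟩ := ih h.2
    rw [listDes, List.length_cons]
    by_cases hd : letter l 0 < a
    · have hup : StartsUp l := fun hlt => h.1 ⟨hd, hlt⟩
      have hne : l ≠ [] := by rintro rfl; simp at hd
      have := ih2 hup hne
      refine ⟨by simp only [hd, if_true]; omega, fun hs => absurd ?_ hs⟩
      simpa using hd
    · simp only [hd, if_false]
      exact ⟨by omega, fun _ _ => by omega⟩

theorem letter_map_lt_iff (f : α ↪o β) (l : List α) (i j : ℕ) :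
    letter (l.map f) i < letter (l.map f) j ↔ letter l i < letter l j := by
  simp only [letter, List.getElem?_map]
  rcases l[i]? with _ | a <;> rcases l[j]? with _ | b <;> simp

theorem letter_map_lt_coe_iff (f : α ↪o β) (l : List α) (a : α) :
    letter (l.map f) 0 < f a ↔ letter l 0 < a := by
  cases l <;> simp

theorem listDes_map (f : α ↪o β) (l : List α) : listDes (l.map f) = listDes l := by
  induction l with
  | nil => rfl
  | cons a l ih => simp only [List.map_cons, listDes, ih, letter_map_lt_coe_iff]

theorem noDoubleDescent_map (f : α ↪o β) (l : List α) :
    NoDoubleDescent (l.map f) ↔ NoDoubleDescent l := by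
  induction l with
  | nil => rfl
  | cons a l ih =>
    simp only [List.map_cons, NoDoubleDescent, ih, letter_map_lt_coe_iff, letter_map_lt_iff]

theorem startsUp_map (f : α ↪o β) (l : List α) : StartsUp (l.map f) ↔ StartsUp l := by
  rw [StartsUp, letter_map_lt_iff, StartsUp]

theorem listInv_map (f : α ↪o β) (l : List α) : listInv (l.map f) = listInv l := by
  induction l with
  | nil => rfl
  | cons a l ih =>
    simp only [List.map_cons, listInv, ih, List.countP_map]
    congr 2
    funext b
    simp

end ListStatistics

/-! ### Weighted enumeration of arrangements of a finite set. -/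

section Enumerators

variable {α β : Type*} [LinearOrder α] [LinearOrder β]

/-- The arrangements of `S`: lists in which each element of `S` occurs once, and nothing else. -/
def arrangements (S : Finset α) : Finset (List α) := S.val.lists.toFinset

theorem mem_arrangements {S : Finset α} {l : List α} : l ∈ arrangements S ↔ S.val = l := by
  rw [arrangements, Multiset.mem_toFinset, Multiset.mem_lists_iff, Multiset.quot_mk_to_coe]

/-- The monomial `q ^ inv * y ^ des` of a list. -/
noncomputable def weight (l : List α) : Polynomial (Polynomial ℚ) :=
  C (X ^ listInv l) * X ^ listDes l

open Classical in
/-- The total weight of the arrangements of `S` with no non-initial double descent. -/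
noncomputable def enumTilde (S : Finset α) : Polynomial (Polynomial ℚ) :=
  ∑ l ∈ (arrangements S).filter NoDoubleDescent, weight l

open Classical in
/-- The total weight of the arrangements of `S` with no non-initial double descent that do not
start with a descent. -/
noncomputable def enumUp (S : Finset α) : Polynomial (Polynomial ℚ) :=
  ∑ l ∈ (arrangements S).filter (fun l => NoDoubleDescent l ∧ StartsUp l), weight l

theorem weight_map (f : α ↪o β) (l : List α) : weight (l.map f) = weight l := by
  rw [weight, listInv_map, listDes_map, weight]

theorem sum_weight_filter_lists_map (f : α ↪o β) (S : Finset α) (p : List α → Prop)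
    (q : List β → Prop) [DecidablePred p] [DecidablePred q]
    (hpq : ∀ l, q (l.map f) ↔ p l) :
    ∑ l ∈ (arrangements (S.map f.toEmbedding)).filter q, weight l =
      ∑ l ∈ (arrangements S).filter p, weight l := by
  symm
  refine Finset.sum_bij (fun l _ => l.map f) ?_ ?_ ?_ ?_
  · intro l hl
    rw [Finset.mem_filter, mem_arrangements] at hl ⊢
    refine ⟨?_, (hpq l).2 hl.2⟩
    rw [Finset.map_val, hl.1]
    rfl
  · intro l _ l' _ h
    exact List.map_injective_iff.2 f.injective h
  · intro l hl
    rw [Finset.mem_filter, mem_arrangements] at hl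
    have hr : l ∈ Set.range (List.map f) := by
      rw [Set.range_list_map]
      intro b hb
      have : b ∈ (S.map f.toEmbedding).val := by rw [hl.1]; exact hb
      obtain ⟨a, _, ha⟩ := Finset.mem_map.1 this
      exact ⟨a, ha⟩
    obtain ⟨l', rfl⟩ := hr
    refine ⟨l', ?_, rfl⟩
    rw [Finset.mem_filter, mem_arrangements]
    refine ⟨Multiset.map_injective f.injective ?_, (hpq l').1 hl.2⟩
    rw [Finset.map_val] at hl
    exact hl.1
  · intro l _
    exact (weight_map f l).symm

theorem enumTilde_map (f : α ↪o β) (S : Finset α) :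
    enumTilde (S.map f.toEmbedding) = enumTilde S := by
  classical
  exact sum_weight_filter_lists_map f S _ _ (noDoubleDescent_map f)

theorem enumUp_map (f : α ↪o β) (S : Finset α) :
    enumUp (S.map f.toEmbedding) = enumUp S := by
  classical
  exact sum_weight_filter_lists_map f S (fun l => NoDoubleDescent l ∧ StartsUp l)
    (fun l => NoDoubleDescent l ∧ StartsUp l) fun l => by
    rw [noDoubleDescent_map, startsUp_map]

theorem map_orderEmbOfFin_univ (S : Finset α) {n : ℕ} (h : S.card = n) :
    (Finset.univ : Finset (Fin n)).map (S.orderEmbOfFin h).toEmbedding = S := by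
  simp

theorem enumTilde_eq_univ (S : Finset α) {n : ℕ} (h : S.card = n) :
    enumTilde S = enumTilde (Finset.univ : Finset (Fin n)) := by
  rw [← enumTilde_map (S.orderEmbOfFin h), map_orderEmbOfFin_univ]

theorem enumUp_eq_univ (S : Finset α) {n : ℕ} (h : S.card = n) :
    enumUp S = enumUp (Finset.univ : Finset (Fin n)) := by
  rw [← enumUp_map (S.orderEmbOfFin h), map_orderEmbOfFin_univ]

/-- Here the value at size `0` differs from `gammaPoly 0`, which is `0`; the value `1` makes the
splitting formula uniform in `B`. -/
theorem enumUp_empty : enumUp (∅ : Finset α) = 1 := by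
  classical
  have : (arrangements (∅ : Finset α)).filter
      (fun l => NoDoubleDescent l ∧ StartsUp l) = {[]} := by
    ext l
    simp only [Finset.mem_filter, mem_arrangements, Finset.mem_singleton]
    constructor
    · rintro ⟨h, -⟩
      simpa using h.symm
    · rintro rfl
      simp [NoDoubleDescent, StartsUp]
  rw [enumUp, this]
  simp [weight, listInv, listDes]

/-- The number of pairs `(a, b) ∈ A × B` with `a > b`. -/
def cross (A B : Finset α) : ℕ := ∑ a ∈ A, (B.filter (fun b => b < a)).card

theorem sum_map_countP_eq_cross {A B : Finset α} {a b : List α} (ha : A.val = a) (hb : B.val = b) :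
    (a.map fun x => b.countP (fun y => y < x)).sum = cross A B := by
  have h : ∀ x, (B.filter (fun y => y < x)).card = b.countP (fun y => y < x) := fun x => by
    rw [Finset.card_def, Finset.filter_val, ← Multiset.countP_eq_card_filter, hb,
      Multiset.coe_countP]
  rw [cross, Finset.sum, ha, Multiset.map_coe, Multiset.sum_coe]
  simp only [h]

theorem weight_append_cons {A B : Finset α} {a b : List α} {m : α} (ha : A.val = a)
    (hb : B.val = b) (hA : ∀ x ∈ A, x < m) (hB : ∀ x ∈ B, x < m) :
    weight (a ++ m :: b) =
      X ^ (if B = ∅ then 0 else 1) * C (X ^ (B.card + cross A B)) * (weight a * weight b) := by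
  have hA' : ∀ x ∈ a, x < m := fun x hx => hA x (by rw [← Finset.mem_val, ha]; exact hx)
  have hB' : ∀ x ∈ b, x < m := fun x hx => hB x (by rw [← Finset.mem_val, hb]; exact hx)
  have hemp : b = [] ↔ B = ∅ := by
    rw [← Finset.val_eq_zero, hb, Multiset.coe_eq_zero]
  have hcard : b.length = B.card := by rw [Finset.card_def, hb, Multiset.coe_card]
  rw [weight, listInv_append_cons a b m hA' hB', listDes_append_cons a b m hA',
    listDes_cons_of_forall_lt b m hB', sum_map_countP_eq_cross ha hb, hcard, weight, weight]
  simp only [hemp, pow_add, map_mul]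
  ring

/-- Splitting the arrangements of `insert m S` at their largest letter `m`. -/
theorem enumTilde_insert {S : Finset α} {m : α} (hm : ∀ x ∈ S, x < m) :
    enumTilde (insert m S) =
      ∑ B ∈ S.powerset, X ^ (if B = ∅ then 0 else 1) * C (X ^ (B.card + cross (S \ B) B)) *
        (enumTilde (S \ B) * enumUp B) := by
  classical
  have hmS : m ∉ S := fun h => lt_irrefl m (hm m h)
  simp only [enumTilde, enumUp, Finset.sum_mul_sum, ← Finset.sum_product']
  simp only [Finset.mul_sum]
  rw [Finset.sum_sigma']
  symm
  refine Finset.sum_bij (fun x _ => x.2.1 ++ m :: x.2.2) ?_ ?_ ?_ ?_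
  · rintro ⟨B, a, b⟩ h
    simp only [Finset.mem_sigma, Finset.mem_powerset, Finset.mem_product, Finset.mem_filter,
      mem_arrangements] at h ⊢
    obtain ⟨hBS, ⟨ha, hda⟩, hb, hdb, hub⟩ := h
    have hA' : ∀ x ∈ a, x < m := fun x hx =>
      hm x (Finset.sdiff_subset (by rw [← Finset.mem_val, ha]; exact hx : x ∈ S \ B))
    have hB' : ∀ x ∈ b, x < m := fun x hx =>
      hm x (hBS (by rw [← Finset.mem_val, hb]; exact hx))
    refine ⟨?_, ?_⟩
    · rw [Finset.insert_val_of_notMem hmS, ← Multiset.coe_add, ← Multiset.cons_coe,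
        Multiset.add_cons, ← ha, ← hb, Finset.sdiff_val, tsub_add_cancel_of_le]
      exact Finset.val_le_iff.2 hBS
    · exact (noDoubleDescent_append_cons a b m hA').2
        ⟨hda, (noDoubleDescent_cons_of_forall_lt b m hB').2 ⟨hdb, hub⟩⟩
  · rintro ⟨B, a, b⟩ h ⟨B', a', b'⟩ h' heq
    simp only [Finset.mem_sigma, Finset.mem_powerset, Finset.mem_product, Finset.mem_filter,
      mem_arrangements] at h h' heq
    -- Since `m` lies in neither part, the cut at `m` is unique.
    have notMem : ∀ {B : Finset α} {a : List α}, (S \ B).val = a → m ∉ a := fun {B a} ha hx =>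
      hmS (Finset.sdiff_subset (by rw [← Finset.mem_val, ha]; exact hx : m ∈ S \ B))
    have notMem' : ∀ {B : Finset α} {b : List α}, B ⊆ S → B.val = b → m ∉ b :=
      fun {B b} hB hb hx => hmS (hB (by rw [← Finset.mem_val, hb]; exact hx))
    obtain ⟨hBS, ⟨ha, -⟩, hb, -⟩ := h
    obtain ⟨hBS', ⟨ha', -⟩, hb', -⟩ := h'
    obtain ⟨rfl, -, rfl⟩ :=
      (List.append_cons_inj_of_notMem (notMem ha') (notMem' hBS' hb')).1 heq.symm
    obtain rfl : B = B' := Finset.val_injective (hb.trans hb'.symm)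
    rfl
  · intro l hl
    rw [Finset.mem_filter, mem_arrangements, Finset.insert_val_of_notMem hmS] at hl
    obtain ⟨hl, hd⟩ := hl
    have hml : m ∈ l := by
      rw [← Multiset.mem_coe, ← hl]; simp
    obtain ⟨a, b, rfl⟩ := List.append_of_mem hml
    rw [← Multiset.coe_add, ← Multiset.cons_coe, Multiset.add_cons, Multiset.cons_inj_right] at hl
    have hnd : (b : Multiset α).Nodup :=
      Multiset.nodup_of_le (by rw [hl]; exact Multiset.le_add_left _ _) S.nodup
    set B : Finset α := ⟨b, hnd⟩
    have hBS : B ⊆ S := Finset.val_le_iff.1 (by rw [hl]; exact Multiset.le_add_left _ _)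
    have ha : (S \ B).val = a := by
      rw [Finset.sdiff_val, hl]
      exact Multiset.add_sub_cancel_right
    have hA' : ∀ x ∈ a, x < m := fun x hx =>
      hm x (Finset.sdiff_subset (by rw [← Finset.mem_val, ha]; exact hx : x ∈ S \ B))
    have hB' : ∀ x ∈ b, x < m := fun x hx => hm x (hBS hx)
    have hd' := (noDoubleDescent_append_cons a b m hA').1 hd
    refine ⟨⟨B, a, b⟩, ?_, rfl⟩
    simp only [Finset.mem_sigma, Finset.mem_powerset, Finset.mem_product, Finset.mem_filter,
      mem_arrangements]
    exact ⟨hBS, ⟨ha, hd'.1⟩, rfl, (noDoubleDescent_cons_of_forall_lt b m hB').1 hd'.2⟩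
  · rintro ⟨B, a, b⟩ h
    simp only [Finset.mem_sigma, Finset.mem_powerset, Finset.mem_product, Finset.mem_filter,
      mem_arrangements] at h
    exact (weight_append_cons h.2.1.1 h.2.2.1
      (fun x hx => hm x (Finset.sdiff_subset hx)) (fun x hx => hm x (h.1 hx))).symm

end Enumerators

/-! ### Crossing inversions and `q`-binomial coefficients. -/

section QBinomial

variable {α : Type*} [LinearOrder α]

/-- The inversion generating function of the splittings of `S` into two parts, the second one of
size `k`. -/
noncomputable def crossSum (S : Finset α) (k : ℕ) : Polynomial ℚ :=
  ∑ B ∈ S.powersetCard k, X ^ cross (S \ B) B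

theorem cross_insert_right {A B : Finset α} {m : α} (hA : ∀ x ∈ A, x < m) :
    cross A (insert m B) = cross A B := by
  refine Finset.sum_congr rfl fun a ha => ?_
  rw [Finset.filter_insert, if_neg (hA a ha).not_gt]

theorem cross_insert_left {A B : Finset α} {m : α} (hA : m ∉ A) (hB : ∀ x ∈ B, x < m) :
    cross (insert m A) B = B.card + cross A B := by
  rw [cross, Finset.sum_insert hA, Finset.filter_true_of_mem hB, cross]

/-- The `q`-Pascal rule: a maximal `m` placed on the right crosses nothing, while on the left it
exceeds all `k + 1` letters of `B`. -/
theorem crossSum_insert_succ {S : Finset α} {m : α} (hm : ∀ x ∈ S, x < m) (k : ℕ) :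
    crossSum (insert m S) (k + 1) = crossSum S k + X ^ (k + 1) * crossSum S (k + 1) := by
  have hmS : m ∉ S := fun h => lt_irrefl m (hm m h)
  have hmB : ∀ {j : ℕ} {B : Finset α}, B ∈ S.powersetCard j → m ∉ B := fun hB h =>
    hmS ((Finset.mem_powersetCard.1 hB).1 h)
  rw [crossSum, Finset.powersetCard_succ_insert hmS, Finset.sum_union, add_comm, Finset.sum_image,
    crossSum, crossSum, Finset.mul_sum]
  · congr 1
    · refine Finset.sum_congr rfl fun B hB => ?_
      rw [Finset.insert_sdiff_insert, Finset.sdiff_insert_of_notMem hmS,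
        cross_insert_right fun x hx => hm x (Finset.sdiff_subset hx)]
    · refine Finset.sum_congr rfl fun B hB => ?_
      have hB' := Finset.mem_powersetCard.1 hB
      rw [Finset.insert_sdiff_of_notMem _ (hmB hB),
        cross_insert_left (fun h => hmS (Finset.sdiff_subset h)) fun x hx => hm x (hB'.1 hx),
        hB'.2, pow_add]
  · intro B hB B' hB' h
    rw [← Finset.erase_insert (hmB hB), ← Finset.erase_insert (hmB hB')]
    exact congrArg (fun s => Finset.erase s m) h
  · rw [Finset.disjoint_left]
    intro B hB h
    obtain ⟨B', -, rfl⟩ := Finset.mem_image.1 h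
    exact hmB hB (Finset.mem_insert_self m B')

theorem crossSum_mul (S : Finset α) (k : ℕ) (hk : k ≤ S.card) :
    crossSum S k * (qPoch k * qPoch (S.card - k)) = qPoch S.card := by
  induction S using Finset.induction_on_max generalizing k with
  | empty =>
    obtain rfl : k = 0 := by simpa using hk
    simp [crossSum, cross, qPoch]
  | insert m S hm ih =>
    have hmS : m ∉ S := fun h => lt_irrefl m (hm m h)
    rw [Finset.card_insert_of_notMem hmS] at hk ⊢
    rcases k with _ | k
    · simp [crossSum, cross, qPoch]
    rw [crossSum_insert_succ hm]
    have h1 := ih k (by omega)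
    rcases Nat.lt_or_ge k S.card with hlt | hge
    · obtain ⟨d, hd⟩ : ∃ d, S.card = k + 1 + d := ⟨S.card - (k + 1), by omega⟩
      have h2 := ih (k + 1) hlt
      rw [hd] at h1 h2 ⊢
      rw [show k + 1 + d - k = d + 1 by omega] at h1
      rw [show k + 1 + d - (k + 1) = d by omega] at h2
      rw [show k + 1 + d + 1 - (k + 1) = d + 1 by omega]
      rw [qPoch_succ (k + 1 + d)]
      rw [qPoch_succ k] at h2 ⊢
      rw [qPoch_succ d] at h1 ⊢
      -- Rests on `1 - q^(k+d+2) = (1 - q^(k+1)) + q^(k+1) (1 - q^(d+1))`.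
      linear_combination (1 - X ^ (k + 1)) * h1 + X ^ (k + 1) * (1 - X ^ (d + 1)) * h2
    · obtain rfl : k = S.card := by omega
      have h0 : crossSum S (S.card + 1) = 0 := by
        rw [crossSum, Finset.powersetCard_eq_empty.2 (Nat.lt_succ_self _), Finset.sum_empty]
      simp only [Nat.sub_self] at h1 ⊢
      rw [h0, qPoch_succ]
      linear_combination (1 - X ^ (S.card + 1)) * h1

theorem crossSum_eq_qBinom (S : Finset α) {k : ℕ} (hk : k ≤ S.card) :
    crossSum S k = qBinom S.card k :=
  mul_right_cancel₀ (mul_ne_zero (qPoch_ne_zero k) (qPoch_ne_zero (S.card - k)))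
    ((crossSum_mul S k hk).trans (qBinom_mul hk).symm)

end QBinomial

/-! ### Translation between permutations and words. -/

section Bridge

theorem word_eq_letter {n : ℕ} (σ : Equiv.Perm (Fin n)) (i : ℕ) :
    word σ (i + 1) = letter (List.ofFn σ) i := by
  rw [word, letter, List.getElem?_ofFn]
  by_cases h : i < n
  · rw [dif_pos ⟨by omega, by omega⟩, dif_pos h]
    rfl
  · rw [dif_neg (by omega), dif_neg h]
    rfl

variable {α : Type*} [LinearOrder α]

/-- Positions past the end contribute nothing, so any large enough `N` serves; this covers the
truncated `n - 1` at `n = 0`. -/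
theorem listDes_eq_sum (l : List α) (N : ℕ) (h : l.length ≤ N + 1) :
    listDes l = ∑ i ∈ Finset.range N, if letter l (i + 1) < letter l i then 1 else 0 := by
  induction l generalizing N with
  | nil => simp [listDes]
  | cons a l ih =>
    rcases N with _ | N
    · obtain rfl : l = [] := by simpa using h
      simp [listDes]
    · rw [listDes, ih N (by simpa using h), Finset.sum_range_succ', add_comm]
      simp

theorem noDoubleDescent_iff (l : List α) :
    NoDoubleDescent l ↔
      ∀ i, ¬ (letter l (i + 1) < letter l i ∧ letter l (i + 2) < letter l (i + 1)) := by
  induction l with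
  | nil => simp [NoDoubleDescent]
  | cons a l ih =>
    rw [NoDoubleDescent, ih]
    constructor
    · rintro ⟨h0, h⟩ (_ | i)
      · simpa using h0
      · simpa using h i
    · intro h
      exact ⟨by simpa using h 0, fun i => by simpa using h (i + 1)⟩

theorem des_eq_listDes {n : ℕ} (σ : Equiv.Perm (Fin n)) : des σ = listDes (List.ofFn σ) := by
  rw [listDes_eq_sum _ (n - 1) (by rw [List.length_ofFn]; omega), des, Finset.card_filter,
    ← Finset.Ico_add_one_right_eq_Icc, Finset.sum_Ico_eq_sum_range]
  refine Finset.sum_congr (by simp) fun i _ => ?_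
  rw [add_comm 1 i, word_eq_letter, word_eq_letter]

theorem dd_eq_zero_iff {n : ℕ} (σ : Equiv.Perm (Fin n)) :
    dd σ = 0 ↔ NoDoubleDescent (List.ofFn σ) := by
  rw [dd, Finset.card_eq_zero, Finset.filter_eq_empty_iff, noDoubleDescent_iff]
  constructor
  · intro h i hi
    by_cases hin : i + 2 ≤ n
    · apply h (Finset.mem_Icc.2 ⟨by omega, hin⟩ : i + 2 ∈ _)
      rw [show i + 2 - 1 = i + 1 by omega, word_eq_letter, word_eq_letter, word_eq_letter]
      exact hi
    · have : letter (List.ofFn σ) (i + 1) = ⊤ := by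
        rw [letter, List.getElem?_eq_none (by rw [List.length_ofFn]; omega)]
        rfl
      simp [this] at hi
  · intro h i hi hdd
    obtain ⟨j, rfl⟩ : ∃ j, i = j + 2 := ⟨i - 2, by have := (Finset.mem_Icc.1 hi).1; omega⟩
    rw [show j + 2 - 1 = j + 1 by omega, word_eq_letter, word_eq_letter, word_eq_letter] at hdd
    exact h j hdd

/-- For `n = 0` both letters are `⊤` and only the weak inequality holds; otherwise equality is
excluded by injectivity or, when `n = 1`, by finiteness of the first letter. -/
theorem word_one_lt_word_two_iff {n : ℕ} (hn : n ≠ 0) (σ : Equiv.Perm (Fin n)) :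
    word σ 1 < word σ 2 ↔ StartsUp (List.ofFn σ) := by
  rw [StartsUp, word_eq_letter σ 0, word_eq_letter σ 1, not_lt]
  refine ⟨le_of_lt, fun h => lt_of_le_of_ne h fun heq => ?_⟩
  rw [← word_eq_letter, ← word_eq_letter, word, word, dif_pos (by omega)] at heq
  split_ifs at heq with h2
  · have := σ.injective (WithTop.coe_injective heq)
    simp at this
  · exact WithTop.coe_ne_top heq

theorem sum_inversions_eq_listInv {n : ℕ} (f : Fin n → α) :
    (∑ i, ∑ j, if i < j ∧ f i > f j then 1 else 0) = listInv (List.ofFn f) := by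
  induction n with
  | zero => simp [listInv]
  | succ n ih =>
    rw [List.ofFn_succ, listInv, ← ih, Fin.sum_univ_succ]
    congr 1
    · rw [Fin.sum_univ_succ]
      simp only [lt_irrefl, false_and, if_false, zero_add, Fin.succ_pos, true_and]
      clear ih
      rw [← Multiset.coe_countP, ← Finset.card_filter, Finset.card_def, Finset.filter_val,
        ← Multiset.countP_eq_card_filter, ← Fin.univ_val_map, Multiset.countP_map,
        Multiset.countP_eq_card_filter]
    · refine Finset.sum_congr rfl fun i _ => ?_
      rw [Fin.sum_univ_succ]
      simp

theorem inv_eq_listInv {n : ℕ} (σ : Equiv.Perm (Fin n)) : inv σ = listInv (List.ofFn σ) := by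
  rw [← sum_inversions_eq_listInv, inv, Finset.card_filter, ← Finset.univ_product_univ,
    Finset.sum_product]

theorem sum_perm_eq_sum_lists {M : Type*} [AddCommMonoid M] (n : ℕ) (p : List (Fin n) → Prop)
    [DecidablePred p] (g : List (Fin n) → M) :
    ∑ σ ∈ Finset.univ.filter (fun σ : Equiv.Perm (Fin n) => p (List.ofFn σ)), g (List.ofFn σ) =
      ∑ l ∈ (arrangements (Finset.univ : Finset (Fin n))).filter p, g l := by
  refine Finset.sum_bij (fun σ _ => List.ofFn σ) ?_ ?_ ?_ ?_
  · intro σ hσ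
    rw [Finset.mem_filter, mem_arrangements]
    refine ⟨?_, (Finset.mem_filter.1 hσ).2⟩
    rw [← Fin.univ_val_map]
    exact (congrArg Finset.val (Finset.map_univ_equiv σ)).symm
  · intro σ _ τ _ h
    exact Equiv.coe_fn_injective (List.ofFn_injective h)
  · intro l hl
    rw [Finset.mem_filter, mem_arrangements] at hl
    have hlen : l.length = n := by
      rw [← Multiset.coe_card, ← hl.1]; simp
    obtain ⟨f, rfl⟩ : ∃ f : Fin n → Fin n, List.ofFn f = l := by
      exact ⟨fun i => l.get (Fin.cast hlen.symm i),
        List.ext_getElem (by simp [hlen]) fun i _ _ => by simp⟩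
    have hinj : Function.Injective f := by
      rw [← List.nodup_ofFn, ← Multiset.coe_nodup, ← hl.1]
      exact Finset.univ.nodup
    exact ⟨Equiv.ofBijective f (Finite.injective_iff_bijective.1 hinj),
      Finset.mem_filter.2 ⟨Finset.mem_univ _, hl.2⟩, rfl⟩
  · intro _ _
    rfl

theorem sum_weight_fiberwise {ι : Type*} (s : Finset ι) (d e : ι → ℕ) (N : ℕ)
    (h : ∀ i ∈ s, d i < N) :
    ∑ k ∈ Finset.range N, C (∑ i ∈ s with d i = k, (X : Polynomial ℚ) ^ e i) * X ^ k =
      ∑ i ∈ s, C (X ^ e i) * (X : Polynomial (Polynomial ℚ)) ^ d i := by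
  rw [← Finset.sum_fiberwise_of_maps_to (fun i hi => Finset.mem_range.2 (h i hi))]
  refine Finset.sum_congr rfl fun k _ => ?_
  rw [map_sum, Finset.sum_mul]
  refine Finset.sum_congr rfl fun i hi => ?_
  rw [(Finset.mem_filter.1 hi).2]

theorem gammaTildePoly_eq (n : ℕ) :
    gammaTildePoly n = enumTilde (Finset.univ : Finset (Fin n)) := by
  classical
  rw [enumTilde, ← sum_perm_eq_sum_lists]
  simp only [weight, ← des_eq_listDes, ← inv_eq_listInv]
  rw [← sum_weight_fiberwise _ _ _ (n / 2 + 1)]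
  · simp only [gammaTildePoly, gammaTildeCoeff, gammaTildeSet, Finset.filter_filter,
      dd_eq_zero_iff]
  · intro σ hσ
    have := (two_mul_listDes_le _ (Finset.mem_filter.1 hσ).2).1
    rw [List.length_ofFn, ← des_eq_listDes] at this
    omega

theorem gammaPoly_eq {n : ℕ} (hn : n ≠ 0) :
    gammaPoly n = enumUp (Finset.univ : Finset (Fin n)) := by
  classical
  rw [enumUp, ← sum_perm_eq_sum_lists]
  simp only [weight, ← des_eq_listDes, ← inv_eq_listInv]
  rw [← sum_weight_fiberwise _ _ _ ((n - 1) / 2 + 1)]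
  · simp only [gammaPoly, gammaCoeff, gammaSet, Finset.filter_filter,
      dd_eq_zero_iff, word_one_lt_word_two_iff hn, and_assoc]
  · intro σ hσ
    have hσ' := (Finset.mem_filter.1 hσ).2
    have := (two_mul_listDes_le _ hσ'.1).2 hσ'.2 (by simpa using hn)
    rw [List.length_ofFn, ← des_eq_listDes] at this
    omega

end Bridge

end QBinomialEulerian

/-! ### The recursion. -/

open QBinomialEulerian in
theorem mainTheorem9 (n : ℕ) :
    QBinomialEulerian.gammaTildePoly (n + 1) =
      QBinomialEulerian.gammaTildePoly n +
        (Polynomial.X : Polynomial (Polynomial ℚ)) *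
          ∑ k ∈ Finset.Icc 1 n,
            Polynomial.C (QBinomialEulerian.qBinom n k * (Polynomial.X : Polynomial ℚ) ^ k) *
              QBinomialEulerian.gammaPoly k * QBinomialEulerian.gammaTildePoly (n - k) := by
  -- Letters are taken in `ℕ`, where removing the largest one needs no change of type.
  have hins : insert n (Finset.range n) = Finset.range (n + 1) := Finset.range_add_one.symm
  rw [gammaTildePoly_eq (n + 1), ← enumTilde_eq_univ (Finset.range (n + 1)) (Finset.card_range _),
    ← hins, enumTilde_insert fun x hx => Finset.mem_range.1 hx, Finset.sum_powerset,
    Finset.card_range, Finset.sum_range_succ', add_comm, gammaTildePoly_eq n]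
  congr 1
  -- The term `B = ∅`: the largest letter comes last.
  · simp [enumUp_empty, cross, enumTilde_eq_univ (Finset.range n) (Finset.card_range n)]
  · rw [← Finset.Ico_add_one_right_eq_Icc, Finset.sum_Ico_eq_sum_range, Finset.mul_sum]
    refine Finset.sum_congr (by simp) fun k hk => ?_
    have hkn : k < n := by simpa using hk
    have hq := crossSum_eq_qBinom (Finset.range n) (k := k + 1) (by simpa using hkn)
    rw [Finset.card_range] at hq
    rw [add_comm 1 k, gammaPoly_eq k.succ_ne_zero, gammaTildePoly_eq, ← hq, crossSum,
      Finset.sum_mul, map_sum, Finset.sum_mul, Finset.sum_mul, Finset.mul_sum]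
    -- For fixed size `k + 1` only the crossing exponent depends on `B`.
    refine Finset.sum_congr rfl fun B hB => ?_
    obtain ⟨hBS, hBc⟩ := Finset.mem_powersetCard.1 hB
    have hne : B ≠ ∅ := by rintro rfl; simp at hBc
    rw [enumUp_eq_univ B hBc, enumTilde_eq_univ (Finset.range n \ B) (n := n - (k + 1))
      (by rw [Finset.card_sdiff_of_subset hBS, hBc, Finset.card_range]), if_neg hne, hBc, pow_one,
      pow_add, map_mul, map_mul]
    ring
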